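/- **Setting.** Let $\mathcal H$ and $\mathcal A$ be separable complex Hilbert spaces with $\dim\mathcal H\ge 2$, and let $|a\rangle\in\mathcal A$ be a fixed unit vector. A *density operator* on a Hilbert space is a nonzero positive trace-class operator, not necessarily of trace $1$; two density operators $\rho,\rho'$ represent the same *state* if $\rho/\mathrm{Tr}(\rho)=\rho'/\mathrm{Tr}(\rho')$. A *measurement* on $\mathcal K$ is a countable family $\langle L_i : i\in I\rangle$ of bounded operators on $\mathcal K$ with $\sum_i L_i^\dagger L_i=\mathrm{Id}$ in the weak operator topology; in the state $\rho$ it has outcome $i$ with probability $\mathrm{Tr}(L_i\rho L_i^\dagger)/\mathrm{Tr}(\rho)$, and then the new state is represented by $L_i\rho L_i^\dagger$. A *quantum circuit* $\mathcal C$ on $\mathcal K=\mathcal H\otimes\mathcal A$ consists of finitely many quantum wires, whose Hilbert spaces have tensor product $\mathcal K$, and of finitely many gates. Each gate acts on the tensor product of the spaces of some of the wires. Each gate is scheduled to fire in one of the stages $1,\dots,N$; gates firing in the same stage share no wire. Each gate $G$ has a finite nonempty set of measurements with disjoint outcome sets, finitely many classical sources (gates scheduled to fire earlier), and a selection function, mapping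 onto the set of $G$ measurements, which picks the $G$ measurement to be performed from the outcomes of the classical sources. (Unitary gates are one-outcome measurements.) A *computation path* $\mu$ assigns to every gate $G$ an outcome $\mu(G)$ of the $G$ measurement that the selection function picks on the outcomes that $\mu$ assigns to the classical sources of $G$. On a density operator $\sigma_0$ on $\mathcal K$, put $\sigma_n=T_n\sigma_{n-1}T_n^\dagger$, where $T_n$ is the tensor product of the operators of the outcomes $\mu(G)$ for the gates $G$ of stage $n$ and of the identity on the remaining wires. Then $\mathrm{Out}_{\mathcal C}(\mu\mid\sigma_0)=\sigma_N$, and the probability that the computation follows $\mu$ is $P_{\mathcal C}(\mu\mid\sigma_0)=\prod_{n=1}^N \mathrm{Tr}(\sigma_n)/\mathrm{Tr}(\sigma_{n-1})$ (zero as soon as some $\sigma_n=0$). $\mathcal C$ *computes* the unitary operator $U$ on $\mathcal H$ *along* $\mu$ if, for every density operator $\rho$ on $\mathcal H$ for which $P_{\mathcal C}(\mu\mid\rho\otimes|a\rangle\langle a|)>0$, the operators $\mathrm{Tr}_{\mathcal A}\,\mathrm{Out}_{\mathcal C}(\mu\mid\rho\otimes|a\rangle\langle a|)$ and $U\rho U^\dagger$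 represent the same state. **Corollary 1.3** (conjectured by Kliuchnikov)**.** Let $\mathcal C$ be a quantum circuit on $\mathcal H\otimes\mathcal A$ and let $U$ be a unitary operator on $\mathcal H$. If $\mathcal C$ computes $U$ along every computation path, then for every computation path $\mu$ the probability $P_{\mathcal C}(\mu\mid\rho\otimes|a\rangle\langle a|)$ is the same for all density operators $\rho$ on $\mathcal H$. In particular, for a single measurement and the identity operator (Busch's "no information without disturbance"): if $\langle L_i : i\in I\rangle$ is a measurement on $\mathcal H$ such that, for every outcome $i$ and every density operator $\rho$ on $\mathcal H$ on which $i$ has positive probability, $L_i\rho L_i^\dagger$ represents the same state as $\rho$, then the probability of each outcome does not depend on $\rho$. -/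

import Mathlib

open scoped TensorProduct InnerProductSpace

noncomputable section

/-! # Traces, density operators, states -/

section Trace

variable {E : Type*} [NormedAddCommGroup E] [InnerProductSpace ℂ E] [CompleteSpace E]

/-- A Hilbert basis of `E`, fixed once and for all. -/
def someHilbertBasis (E : Type*) [NormedAddCommGroup E] [InnerProductSpace ℂ E]
    [CompleteSpace E] : HilbertBasis (exists_hilbertBasis ℂ E).choose ℂ E :=
  (exists_hilbertBasis ℂ E).choose_spec.choose

/-- The trace of an operator, as the sum of its diagonal entries in a Hilbert basis. It is only used
for positive trace-class operators, where the sum converges, is real, and is independent of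
the basis; so it is taken to be real-valued. -/
def opTrace (T : E →L[ℂ] E) : ℝ :=
  ∑' i, (⟪someHilbertBasis E i, T (someHilbertBasis E i)⟫_ℂ).re

/-- Density operators, not necessarily normalized: nonzero positive operators of finite trace. -/
structure IsDensity (ρ : E →L[ℂ] E) : Prop where
  isPositive : ρ.IsPositive
  ne_zero : ρ ≠ 0
  summable : Summable fun i =>
    (⟪someHilbertBasis E i, ρ (someHilbertBasis E i)⟫_ℂ).re

/-- Two density operators represent the same state if their normalized versions coincide. -/
def SameState (ρ ρ' : E →L[ℂ] E) : Prop :=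
  (opTrace ρ)⁻¹ • ρ = (opTrace ρ')⁻¹ • ρ'

variable {F : Type*} [NormedAddCommGroup F] [InnerProductSpace ℂ F] [CompleteSpace F]

/-- `T ρ T†`. -/
def opConj (T : E →L[ℂ] F) (ρ : E →L[ℂ] E) : F →L[ℂ] F :=
  T ∘L ρ ∘L ContinuousLinearMap.adjoint T

/-- A (general) measurement on the Hilbert space `E` with outcomes in `I`: operators `L i` such that
`∑ i, (L i)† (L i)` converges to the identity in the weak operator topology. -/
structure Measurement (E : Type*) [NormedAddCommGroup E] [InnerProductSpace ℂ E]
    [CompleteSpace E] (I : Type*) where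
  op : I → E →L[ℂ] E
  complete : ∀ x y : E,
    HasSum (fun i => ⟪x, (ContinuousLinearMap.adjoint (op i) ∘L op i) y⟫_ℂ) ⟪x, y⟫_ℂ

/-- The probability that the measurement `M` in the state represented by `ρ` has outcome `i`.
The post-measurement state is represented by `opConj (M.op i) ρ`. -/
def Measurement.prob {I : Type*} (M : Measurement E I) (i : I) (ρ : E →L[ℂ] E) : ℝ :=
  opTrace (opConj (M.op i) ρ) / opTrace ρ

end Trace

/-! # Hilbert tensor product of two spaces -/

section Bipartite

variable (H A : Type*) [NormedAddCommGroup H] [InnerProductSpace ℂ H]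
  [NormedAddCommGroup A] [InnerProductSpace ℂ A]

/-- The Hilbert space tensor product: the completion of the algebraic tensor product for the inner
product with `⟪x ⊗ a, y ⊗ b⟫ = ⟪x, y⟫ ⟪a, b⟫`. -/
abbrev HTensor : Type _ := UniformSpace.Completion (H ⊗[ℂ] A)

variable {H A}

/-- The operator `x ↦ x ⊗ a` from `H` to `H ⊗ A`. -/
def tensorRight (a : A) : H →L[ℂ] HTensor H A :=
  UniformSpace.Completion.toComplL ∘L (TensorProduct.mkL ℂ H A).flip a

theorem tensorRight_apply (a : A) (x : H) :
    tensorRight a x = ((x ⊗ₜ[ℂ] a : H ⊗[ℂ] A) : HTensor H A) := rfl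

variable [CompleteSpace H]

/-- The full input `ρ ⊗ |a⟩⟨a|`; see `withAncilla_tmul`. -/
def withAncilla (a : A) (ρ : H →L[ℂ] H) : HTensor H A →L[ℂ] HTensor H A :=
  opConj (tensorRight a) ρ

theorem withAncilla_tmul (a b : A) (ρ : H →L[ℂ] H) (x : H) :
    withAncilla a ρ ((x ⊗ₜ[ℂ] b : H ⊗[ℂ] A) : HTensor H A) =
      ⟪a, b⟫_ℂ • ((ρ x ⊗ₜ[ℂ] a : H ⊗[ℂ] A) : HTensor H A) := by
  have h : ContinuousLinearMap.adjoint (tensorRight a)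
      ((x ⊗ₜ[ℂ] b : H ⊗[ℂ] A) : HTensor H A) = ⟪a, b⟫_ℂ • x := by
    refine ext_inner_left ℂ fun y => ?_
    rw [ContinuousLinearMap.adjoint_inner_right, tensorRight_apply,
      UniformSpace.Completion.inner_coe, TensorProduct.inner_tmul, inner_smul_right, mul_comm]
  simp only [withAncilla, opConj, ContinuousLinearMap.comp_apply, h, map_smul, tensorRight_apply]

/-- The partial trace over `A`: with `e i` running over a Hilbert basis of `A`, it is the sum of the
operators `(1 ⊗ ⟨e i|) σ (1 ⊗ |e i⟩)`. For positive trace-class `σ` the series converges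
absolutely in norm. -/
def partialTrace [CompleteSpace A] (σ : HTensor H A →L[ℂ] HTensor H A) : H →L[ℂ] H :=
  ∑' i, ContinuousLinearMap.adjoint (tensorRight (H := H) (someHilbertBasis A i)) ∘L σ ∘L
    tensorRight (someHilbertBasis A i)

end Bipartite

/-! # Hilbert tensor product of a finite family of spaces -/

/-- A realization of the Hilbert space `T` as the tensor product of the finite family `E` of
Hilbert spaces: a multilinear map `x ↦ ⨂ x i` satisfying `⟪⨂ x i, ⨂ y i⟫ = ∏ ⟪x i, y i⟫`, whose
values span a dense subspace. These properties determine `T` up to a unique unitary that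
respects the product vectors. -/
structure HilbertTensor {ι : Type*} [Fintype ι] (E : ι → Type*)
    [∀ i, NormedAddCommGroup (E i)] [∀ i, InnerProductSpace ℂ (E i)]
    (T : Type*) [NormedAddCommGroup T] [InnerProductSpace ℂ T] where
  tprod : MultilinearMap ℂ E T
  inner_tprod : ∀ x y, ⟪tprod x, tprod y⟫_ℂ = ∏ i, ⟪x i, y i⟫_ℂ
  dense_span : Dense (Submodule.span ℂ (Set.range tprod) : Set T)

section Gram

variable {X : Type*} {T₁ T₂ T₃ : Type*}
  [NormedAddCommGroup T₁] [InnerProductSpace ℂ T₁]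
  [NormedAddCommGroup T₂] [InnerProductSpace ℂ T₂]
  [NormedAddCommGroup T₃] [InnerProductSpace ℂ T₃]

theorem norm_sq_linearCombination_add (u : X → T₁) (v : X → T₂) (w : X → T₃) (M : ℝ)
    (h : ∀ a b, ⟪v a, v b⟫_ℂ + ⟪w a, w b⟫_ℂ = M * ⟪u a, u b⟫_ℂ) (f : X →₀ ℂ) :
    ‖Finsupp.linearCombination ℂ v f‖ ^ 2 + ‖Finsupp.linearCombination ℂ w f‖ ^ 2 =
      M * ‖Finsupp.linearCombination ℂ u f‖ ^ 2 := by
  have key : ⟪Finsupp.linearCombination ℂ v f, Finsupp.linearCombination ℂ v f⟫_ℂ +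
      ⟪Finsupp.linearCombination ℂ w f, Finsupp.linearCombination ℂ w f⟫_ℂ =
      M * ⟪Finsupp.linearCombination ℂ u f, Finsupp.linearCombination ℂ u f⟫_ℂ := by
    simp only [Finsupp.linearCombination_apply, Finsupp.sum, sum_inner, inner_sum,
      inner_smul_left, inner_smul_right, Finset.mul_sum, ← Finset.sum_add_distrib]
    refine Finset.sum_congr rfl fun a _ => Finset.sum_congr rfl fun b _ => ?_
    linear_combination (starRingEnd ℂ (f b) * f a) * h b a
  have key' := congrArg Complex.re key
  rw [Complex.add_re, Complex.re_ofReal_mul] at key'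
  rw [← inner_self_eq_norm_sq (𝕜 := ℂ), ← inner_self_eq_norm_sq (𝕜 := ℂ),
    ← inner_self_eq_norm_sq (𝕜 := ℂ)]
  exact key'

theorem denseRange_linearCombination (u : X → T₁)
    (h : Dense (Submodule.span ℂ (Set.range u) : Set T₁)) :
    DenseRange (Finsupp.linearCombination ℂ u) := by
  rw [← Finsupp.range_linearCombination, LinearMap.coe_range] at h
  exact h

end Gram

section Ampliation

variable {ι : Type*} [Fintype ι] [DecidableEq ι] {E : ι → Type*}
  [∀ i, NormedAddCommGroup (E i)] [∀ i, InnerProductSpace ℂ (E i)]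
  {K : Type*} [NormedAddCommGroup K] [InnerProductSpace ℂ K] [CompleteSpace K]
  {S : Finset ι} {T : Type*} [NormedAddCommGroup T] [InnerProductSpace ℂ T]

/-- The family that agrees with `x` on `S` and with `z` off `S`. -/
def mergeOn (S : Finset ι) (x : ∀ i : S, E i) (z : ∀ i, E i) : ∀ i, E i :=
  fun i => if h : i ∈ S then x ⟨i, h⟩ else z i

theorem prod_inner_mergeOn (x x' : ∀ i : S, E i) (z z' : ∀ i, E i) :
    ∏ i, ⟪mergeOn S x z i, mergeOn S x' z' i⟫_ℂ =
      (∏ i : S, ⟪x i, x' i⟫_ℂ) * ∏ i ∈ Sᶜ, ⟪z i, z' i⟫_ℂ := by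
  rw [← Finset.prod_mul_prod_compl S]
  congr 1
  · rw [← Finset.prod_coe_sort]
    exact Finset.prod_congr rfl fun i _ => by simp [mergeOn]
  · exact Finset.prod_congr rfl fun i hi => by simp [mergeOn, Finset.mem_compl.1 hi]

/-- For `s` in the tensor product `T` of the spaces `E i`, `i ∈ S`, the vector `s ⊗ ⨂_{i ∉ S} z i`
of the full tensor product `K`. -/
def insertVec (τ : HilbertTensor E K) (τS : HilbertTensor (fun i : S => E i) T)
    (z : ∀ i, E i) : T →L[ℂ] K :=
  (Finsupp.linearCombination ℂ fun x => τ.tprod (mergeOn S x z)).extendOfNorm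
    (Finsupp.linearCombination ℂ τS.tprod)

theorem insertVec_tprod (τ : HilbertTensor E K) (τS : HilbertTensor (fun i : S => E i) T)
    (z : ∀ i, E i) (x : ∀ i : S, E i) :
    insertVec τ τS z (τS.tprod x) = τ.tprod (mergeOn S x z) := by
  have hb : ∀ f, ‖Finsupp.linearCombination ℂ (fun x => τ.tprod (mergeOn S x z)) f‖ ≤
      (∏ i ∈ Sᶜ, ‖z i‖) * ‖Finsupp.linearCombination ℂ τS.tprod f‖ := by
    intro f
    have h := norm_sq_linearCombination_add (T₃ := ℂ) τS.tprod
      (fun x => τ.tprod (mergeOn S x z)) (fun _ => 0) ((∏ i ∈ Sᶜ, ‖z i‖) ^ 2) (fun a b => by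
        rw [τ.inner_tprod, τS.inner_tprod, prod_inner_mergeOn, inner_zero_left, add_zero, mul_comm]
        congr 1
        simp [inner_self_eq_norm_sq_to_K, Finset.prod_pow]) f
    refine le_of_sq_le_sq ?_ (by positivity)
    rw [mul_pow, ← h]
    nlinarith [sq_nonneg ‖Finsupp.linearCombination ℂ (fun _ => (0 : ℂ)) f‖]
  have := LinearMap.extendOfNorm_eq (denseRange_linearCombination _ τS.dense_span) ⟨_, hb⟩
    (Finsupp.single x 1)
  simpa [insertVec] using this

theorem inner_insertVec (τ : HilbertTensor E K) (τS : HilbertTensor (fun i : S => E i) T)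
    (z z' : ∀ i, E i) (s s' : T) :
    ⟪insertVec τ τS z s, insertVec τ τS z' s'⟫_ℂ = ⟪s, s'⟫_ℂ * ∏ i ∈ Sᶜ, ⟪z i, z' i⟫_ℂ := by
  have hd := denseRange_linearCombination _ τS.dense_span
  have step : ∀ (x : ∀ i : S, E i) (t : T),
      ⟪insertVec τ τS z (τS.tprod x), insertVec τ τS z' t⟫_ℂ =
        ⟪τS.tprod x, t⟫_ℂ * ∏ i ∈ Sᶜ, ⟪z i, z' i⟫_ℂ := by
    intro x t
    refine hd.induction_on (p := fun t => ⟪insertVec τ τS z (τS.tprod x),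
      insertVec τ τS z' t⟫_ℂ = ⟪τS.tprod x, t⟫_ℂ * ∏ i ∈ Sᶜ, ⟪z i, z' i⟫_ℂ) t
      (isClosed_eq (by fun_prop) (by fun_prop)) fun f => ?_
    simp only [Finsupp.linearCombination_apply, Finsupp.sum, map_sum, map_smul, inner_sum,
      inner_smul_right, Finset.sum_mul, insertVec_tprod, τ.inner_tprod, τS.inner_tprod,
      prod_inner_mergeOn, mul_assoc]
  refine hd.induction_on (p := fun s => ⟪insertVec τ τS z s, insertVec τ τS z' s'⟫_ℂ =
    ⟪s, s'⟫_ℂ * ∏ i ∈ Sᶜ, ⟪z i, z' i⟫_ℂ) s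
    (isClosed_eq (by fun_prop) (by fun_prop)) fun f => ?_
  simp only [Finsupp.linearCombination_apply, Finsupp.sum, map_sum, map_smul, sum_inner,
    inner_smul_left, Finset.sum_mul, step, mul_assoc]

variable [CompleteSpace T]

/-- The operator `L ⊗ 1` on the full tensor product `K`, for an operator `L` on the tensor product
`T` of the spaces `E i`, `i ∈ S`. It is the bounded operator with
`s ⊗ ⨂_{i ∉ S} z i ↦ L s ⊗ ⨂_{i ∉ S} z i`; see `ampliation_insertVec`. -/
def ampliation (τ : HilbertTensor E K) (τS : HilbertTensor (fun i : S => E i) T)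
    (L : T →L[ℂ] T) : K →L[ℂ] K :=
  (Finsupp.linearCombination ℂ fun p : T × (∀ i, E i) =>
      insertVec τ τS p.2 (L p.1)).extendOfNorm
    (Finsupp.linearCombination ℂ fun p : T × (∀ i, E i) => insertVec τ τS p.2 p.1)

theorem ampliation_insertVec (τ : HilbertTensor E K) (τS : HilbertTensor (fun i : S => E i) T)
    (L : T →L[ℂ] T) (z : ∀ i, E i) (s : T) :
    ampliation τ τS L (insertVec τ τS z s) = insertVec τ τS z (L s) := by
  have hd : DenseRange (Finsupp.linearCombination ℂ fun p : T × (∀ i, E i) =>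
      insertVec τ τS p.2 p.1) := by
    refine denseRange_linearCombination _ (τ.dense_span.mono (Submodule.span_mono ?_))
    rintro _ ⟨x, rfl⟩
    refine ⟨(τS.tprod fun i => x i, x), ?_⟩
    simp only [insertVec_tprod]
    congr 1
    ext i
    simp [mergeOn]
  -- the positive square root of `‖L‖² - L† L`
  obtain ⟨C, hC⟩ : ∃ C : T →L[ℂ] T, ∀ x y, ⟪L x, L y⟫_ℂ + ⟪C x, C y⟫_ℂ =
      ((‖L‖ ^ 2 : ℝ) : ℂ) * ⟪x, y⟫_ℂ := by
    set B : T →L[ℂ] T := ((‖L‖ ^ 2 : ℝ) : ℂ) • 1 - ContinuousLinearMap.adjoint L ∘L L with hB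
    have hB0 : 0 ≤ B := by
      rw [ContinuousLinearMap.nonneg_iff_isPositive, ContinuousLinearMap.isPositive_iff_complex]
      intro x
      have e : ⟪B x, x⟫_ℂ = ((‖L‖ ^ 2 * ‖x‖ ^ 2 - ‖L x‖ ^ 2 : ℝ) : ℂ) := by
        have h1 : ⟪x, x⟫_ℂ = ((‖x‖ ^ 2 : ℝ) : ℂ) := by
          rw [inner_self_eq_norm_sq_to_K]; push_cast; rfl
        have h2 : ⟪L x, L x⟫_ℂ = ((‖L x‖ ^ 2 : ℝ) : ℂ) := by
          rw [inner_self_eq_norm_sq_to_K]; push_cast; rfl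
        rw [hB, sub_apply, inner_sub_left, smul_apply,
          inner_smul_left, ContinuousLinearMap.comp_apply, ContinuousLinearMap.adjoint_inner_left,
          one_apply_eq_self, h1, h2, Complex.conj_ofReal]
        push_cast
        rfl
      rw [e]
      refine ⟨congrArg _ (Complex.ofReal_re _), ?_⟩
      have := L.le_opNorm x
      have h2 := mul_self_le_mul_self (norm_nonneg _) this
      rw [show RCLike.re ((‖L‖ ^ 2 * ‖x‖ ^ 2 - ‖L x‖ ^ 2 : ℝ) : ℂ) =
        ‖L‖ ^ 2 * ‖x‖ ^ 2 - ‖L x‖ ^ 2 from Complex.ofReal_re _]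
      nlinarith
    refine ⟨CFC.sqrt B, fun x y => ?_⟩
    have hsa : ContinuousLinearMap.adjoint (CFC.sqrt B) = CFC.sqrt B :=
      (IsSelfAdjoint.of_nonneg (CFC.sqrt_nonneg B)).star_eq
    have hsq : (CFC.sqrt B) ((CFC.sqrt B) y) = B y := by
      rw [← mul_apply_eq_comp, CFC.sqrt_mul_sqrt_self B hB0]
    have : ⟪CFC.sqrt B x, CFC.sqrt B y⟫_ℂ = ⟪x, B y⟫_ℂ := by
      rw [← ContinuousLinearMap.adjoint_inner_right, hsa, hsq]
    rw [this]
    simp [hB, ContinuousLinearMap.adjoint_inner_right]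
  have hb : ∀ f, ‖Finsupp.linearCombination ℂ (fun p : T × (∀ i, E i) =>
      insertVec τ τS p.2 (L p.1)) f‖ ≤
      ‖L‖ * ‖Finsupp.linearCombination ℂ (fun p : T × (∀ i, E i) =>
        insertVec τ τS p.2 p.1) f‖ := by
    intro f
    have h := norm_sq_linearCombination_add
      (fun p : T × (∀ i, E i) => insertVec τ τS p.2 p.1)
      (fun p : T × (∀ i, E i) => insertVec τ τS p.2 (L p.1))
      (fun p : T × (∀ i, E i) => insertVec τ τS p.2 (C p.1)) (‖L‖ ^ 2) (fun a b => by
        rw [inner_insertVec, inner_insertVec, inner_insertVec, ← add_mul, hC, mul_assoc]) f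
    refine le_of_sq_le_sq ?_ (by positivity)
    rw [mul_pow, ← h]
    nlinarith [sq_nonneg ‖Finsupp.linearCombination ℂ (fun p : T × (∀ i, E i) =>
      insertVec τ τS p.2 (C p.1)) f‖]
  have := LinearMap.extendOfNorm_eq hd ⟨_, hb⟩ (Finsupp.single (s, z) 1)
  simpa [ampliation] using this

end Ampliation

/-! # Quantum circuits -/

/-- A quantum circuit, with a fixed execution schedule, on the Hilbert space `K`.

`K` is the tensor product of finitely many quantum wires. Every gate acts on a set of wires,
and its Hilbert space is the tensor product of these. The gates fire in `numStages` stages: the `n`-th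
bout of the schedule is the set of gates `G` with `stage G = n`. Along each wire the quantum channels
lead from each gate acting on that wire to the next one in the schedule; so gates in one
bout share no wire. Classical channels lead to `G` from the gates in `sources G`, which fire before.

Every gate `G` has finitely many measurements, indexed by `Meas G`. An outcome of `G` is a pair
consisting of a `G` measurement and one of its outcomes, so that different measurements have disjoint
outcome sets. Unitary gates are measurements with a single outcome. -/
structure QCircuit (K : Type*) [NormedAddCommGroup K] [InnerProductSpace ℂ K]
    [CompleteSpace K] where
  Wire : Type
  [wireFintype : Fintype Wire]
  [wireDecEq : DecidableEq Wire]
  wireSpace : Wire → Type*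
  [wireNormed : ∀ w, NormedAddCommGroup (wireSpace w)]
  [wireInner : ∀ w, InnerProductSpace ℂ (wireSpace w)]
  [wireComplete : ∀ w, CompleteSpace (wireSpace w)]
  wires : HilbertTensor wireSpace K
  Gate : Type
  [gateFintype : Fintype Gate]
  /-- The fixed linear order of the gates. It carries no information, because the
  operators of the gates of one bout commute. -/
  [gateOrder : LinearOrder Gate]
  numStages : ℕ
  stage : Gate → Fin numStages
  gateWires : Gate → Finset Wire
  disjoint_gateWires : ∀ F G, F ≠ G → stage F = stage G → Disjoint (gateWires F) (gateWires G)
  gateSpace : Gate → Type*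
  [gateNormed : ∀ G, NormedAddCommGroup (gateSpace G)]
  [gateInner : ∀ G, InnerProductSpace ℂ (gateSpace G)]
  [gateComplete : ∀ G, CompleteSpace (gateSpace G)]
  gateTensor : ∀ G, HilbertTensor (fun w : gateWires G => wireSpace w) (gateSpace G)
  sources : Gate → Finset Gate
  stage_lt_of_mem_sources : ∀ F G, F ∈ sources G → stage F < stage G
  Meas : Gate → Type
  [measFinite : ∀ G, Finite (Meas G)]
  [measNonempty : ∀ G, Nonempty (Meas G)]
  Outcome : ∀ G, Meas G → Type
  [outcomeCountable : ∀ G m, Countable (Outcome G m)]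
  measurement : ∀ G (m : Meas G), Measurement (gateSpace G) (Outcome G m)
  /-- The selection function of `G`: it picks the `G` measurement to be performed, given the
  outcomes of the classical sources of `G`. -/
  select : ∀ G, (∀ F : sources G, Σ m : Meas F, Outcome F m) → Meas G
  select_surjective : ∀ G, Function.Surjective (select G)

namespace QCircuit

attribute [instance] wireFintype wireDecEq wireNormed wireInner wireComplete gateFintype
  gateOrder gateNormed gateInner gateComplete measFinite measNonempty outcomeCountable

variable {K : Type*} [NormedAddCommGroup K] [InnerProductSpace ℂ K] [CompleteSpace K]

/-- A computation path: it assigns to every gate `G` an outcome of the `G` measurement picked by the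
selection function of `G` on the outcomes assigned to the classical sources of `G`. -/
structure Path (C : QCircuit K) where
  outcome : ∀ G : C.Gate, Σ m : C.Meas G, C.Outcome G m
  coherent : ∀ G, (outcome G).1 = C.select G fun F => outcome F

variable (C : QCircuit K)

/-- The operator on `K` by which gate `G` acts along the path `μ`. -/
def gateOp (μ : C.Path) (G : C.Gate) : K →L[ℂ] K :=
  ampliation C.wires (C.gateTensor G) ((C.measurement G (μ.outcome G).1).op (μ.outcome G).2)

/-- The operator on `K` by which the `n`-th bout (counted from 0) acts along the path `μ`: the tensor
product of the operators of its gates and of the identity on the wires not used. -/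
def boutOp (μ : C.Path) (n : ℕ) : K →L[ℂ] K :=
  (((Finset.univ.filter fun G => (C.stage G : ℕ) = n).sort (· ≤ ·)).map (C.gateOp μ)).prod

/-- The (unnormalized) state after the first `n` bouts when the computation on the full input `σ`
follows the path `μ`. -/
def stateAfter (μ : C.Path) (σ : K →L[ℂ] K) : ℕ → (K →L[ℂ] K)
  | 0 => σ
  | n + 1 => opConj (C.boutOp μ n) (stateAfter μ σ n)

/-- The output of the computation on the full input `σ` that follows the path `μ`. -/
def out (μ : C.Path) (σ : K →L[ℂ] K) : K →L[ℂ] K := C.stateAfter μ σ C.numStages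

/-- The probability that the computation on the full input `σ` follows the path `μ`: the product over
the bouts of the probabilities, in the current state, of the outcomes prescribed by `μ`.
(If one of these probabilities is zero, then so is the product.) -/
def prob (μ : C.Path) (σ : K →L[ℂ] K) : ℝ :=
  ∏ n ∈ Finset.range C.numStages,
    opTrace (C.stateAfter μ σ (n + 1)) / opTrace (C.stateAfter μ σ n)

end QCircuit

namespace QCircuit

variable {H A : Type*} [NormedAddCommGroup H] [InnerProductSpace ℂ H] [CompleteSpace H]
  [NormedAddCommGroup A] [InnerProductSpace ℂ A] [CompleteSpace A]

/-- The circuit `C`, with ancilla initialized to `a`, computes `U` along the path `μ`: on every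
principal input `ρ` on which `μ` can be followed at all, the principal output
`Tr_A (Out (μ | ρ ⊗ |a⟩⟨a|))` represents the same state as `U ρ U†`. -/
def ComputesAlong (C : QCircuit (HTensor H A)) (a : A) (U : H →L[ℂ] H) (μ : C.Path) : Prop :=
  ∀ ρ : H →L[ℂ] H, IsDensity ρ → 0 < C.prob μ (withAncilla a ρ) →
    SameState (partialTrace (C.out μ (withAncilla a ρ))) (opConj U ρ)

end QCircuit

end

/-! ### Traces, density operators and pure states. -/

section Trace

variable {E F : Type*} [NormedAddCommGroup E] [InnerProductSpace ℂ E] [CompleteSpace E]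
  [NormedAddCommGroup F] [InnerProductSpace ℂ F] [CompleteSpace F]

/-! Along a path `μ` the whole computation is a single operator `W : H → H ⊗ A`, the product of the
bout operators applied to `x ⊗ a`, and the path probability telescopes to `Tr(W ρ W†) / Tr ρ`. This
is constant in `ρ` once `W` is a multiple of an isometry (`opTrace_opConj_of_norm_sq`).

Pure inputs suffice to see that it is. Let `w_k = (1 ⊗ ⟨e_k|) W x` be the slices of `W x` along a
Hilbert basis of `A`. The reduced output is `∑ |w_k⟩⟨w_k|`, and by hypothesis it is proportional to
`|U x⟩⟨U x|`. A sum of positive operators is supported on a line only if every summand is, so each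
`w_k` is a multiple of `U x` (`mem_span_of_sameState_rankOne`). Hence every `x` is an eigenvector of
`U† (1 ⊗ ⟨e_k|) W`, which is therefore a scalar `c_k`, and `‖W x‖² = ∑ ‖w_k‖² = (∑ |c_k|²) ‖x‖²`
(`exists_norm_sq_eq_of_sameState_partialTrace`). The statement on a single measurement is the same
argument without the ancilla. -/

omit [CompleteSpace E] in
theorem HilbertBasis.hasSum_norm_inner_sq {ι : Type*} (b : HilbertBasis ι ℂ E) (x : E) :
    HasSum (fun i => ‖⟪b i, x⟫_ℂ‖ ^ 2) (‖x‖ ^ 2) := by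
  have h := (b.hasSum_inner_mul_inner x x).mapL Complex.reCLM
  convert! h using 1
  · ext i
    rw [Complex.reCLM_apply, ← inner_conj_symm x, Complex.conj_mul']
    norm_cast
  · exact (inner_self_eq_norm_sq (𝕜 := ℂ) x).symm

/-- Parseval in `ENNReal`, where double sums can be exchanged without summability conditions. -/
theorem HilbertBasis.tsum_nnnorm_inner_sq {ι : Type*} (b : HilbertBasis ι ℂ E) (x : E) :
    ∑' i, ((‖⟪b i, x⟫_ℂ‖₊ ^ 2 : NNReal) : ENNReal) = ((‖x‖₊ ^ 2 : NNReal) : ENNReal) := by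
  refine (ENNReal.hasSum_coe.2 (NNReal.hasSum_coe.1 ?_)).tsum_eq
  simpa using b.hasSum_norm_inner_sq x

theorem HilbertBasis.eq_zero_of_inner_eq_zero {ι : Type*} (b : HilbertBasis ι ℂ E) {x : E}
    (h : ∀ i, ⟪b i, x⟫_ℂ = 0) : x = 0 := by
  have := b.hasSum_norm_inner_sq x
  simp only [h, norm_zero, ne_eq, OfNat.ofNat_ne_zero, not_false_eq_true, zero_pow] at this
  simpa using this.unique hasSum_zero

theorem HilbertBasis.continuousLinearMap_eq_zero {ι : Type*} (b : HilbertBasis ι ℂ E)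
    {T : E →L[ℂ] F} (h : ∀ i, T (b i) = 0) : T = 0 := by
  ext x
  refine ext_inner_right ℂ fun y => ?_
  rw [zero_apply, inner_zero_left, ← ContinuousLinearMap.adjoint_inner_right,
    b.eq_zero_of_inner_eq_zero (x := ContinuousLinearMap.adjoint T y) fun i => by
      rw [ContinuousLinearMap.adjoint_inner_right, h, inner_zero_left], inner_zero_right]

/-- The Hilbert-Schmidt norms of an operator and of its adjoint agree. -/
theorem hasSum_norm_adjoint_sq {ι κ : Type*} (b : HilbertBasis ι ℂ E) (c : HilbertBasis κ ℂ F)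
    (T : E →L[ℂ] F) {s : ℝ} (h : HasSum (fun i => ‖T (b i)‖ ^ 2) s) :
    HasSum (fun j => ‖ContinuousLinearMap.adjoint T (c j)‖ ^ 2) s := by
  lift s to NNReal using h.nonneg fun _ => by positivity
  have h' : HasSum (fun i => ‖T (b i)‖₊ ^ 2) s := NNReal.hasSum_coe.1 (by simpa using h)
  have key : HasSum (fun j => ‖ContinuousLinearMap.adjoint T (c j)‖₊ ^ 2) s := by
    rw [← ENNReal.hasSum_coe, ENNReal.summable.hasSum_iff] at h' ⊢
    rw [← h']
    -- Both sides become the sum of the squared moduli of all matrix entries of `T`, in the two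
    -- orders of summation.
    simp_rw [← c.tsum_nnnorm_inner_sq, ← b.tsum_nnnorm_inner_sq]
    rw [ENNReal.tsum_comm]
    refine tsum_congr fun i => tsum_congr fun j => ?_
    rw [ContinuousLinearMap.adjoint_inner_right, ← inner_conj_symm, RCLike.nnnorm_conj]
  simpa using NNReal.hasSum_coe.2 key

theorem opConj_comp {G : Type*} [NormedAddCommGroup G] [InnerProductSpace ℂ G] [CompleteSpace G]
    (T : F →L[ℂ] G) (R : E →L[ℂ] F) (ρ : E →L[ℂ] E) :
    opConj (T ∘L R) ρ = opConj T (opConj R ρ) := by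
  simp only [opConj, ContinuousLinearMap.adjoint_comp, ContinuousLinearMap.comp_assoc]

theorem opConj_id (ρ : E →L[ℂ] E) : opConj (ContinuousLinearMap.id ℂ E) ρ = ρ := by
  rw [opConj, ← ContinuousLinearMap.one_def, ← ContinuousLinearMap.star_eq_adjoint, star_one]
  rfl

theorem opConj_zero (T : E →L[ℂ] F) : opConj T (0 : E →L[ℂ] E) = 0 := by
  simp [opConj]

theorem opConj_rankOne (T : E →L[ℂ] F) (x : E) :
    opConj T (InnerProductSpace.rankOne ℂ x x) = InnerProductSpace.rankOne ℂ (T x) (T x) := by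
  rw [opConj, InnerProductSpace.rankOne_comp, ContinuousLinearMap.adjoint_adjoint,
    InnerProductSpace.comp_rankOne]

theorem re_inner_opConj_id (R : E →L[ℂ] F) (x : F) :
    (⟪x, opConj R (ContinuousLinearMap.id ℂ E) x⟫_ℂ).re =
      ‖ContinuousLinearMap.adjoint R x‖ ^ 2 := by
  rw [opConj, ContinuousLinearMap.id_comp, ContinuousLinearMap.comp_apply,
    ← ContinuousLinearMap.adjoint_inner_left]
  exact inner_self_eq_norm_sq (𝕜 := ℂ) _

/-- A density operator factors as `S S†` with `S` of finite Hilbert-Schmidt norm. -/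
theorem IsDensity.exists_eq_opConj_id {ρ : E →L[ℂ] E} (hρ : IsDensity ρ) :
    ∃ S : E →L[ℂ] E, opConj S (ContinuousLinearMap.id ℂ E) = ρ ∧
      HasSum (fun i => ‖S (someHilbertBasis E i)‖ ^ 2) (opTrace ρ) := by
  have h0 : 0 ≤ ρ := (ContinuousLinearMap.nonneg_iff_isPositive ρ).2 hρ.isPositive
  have hsa : ContinuousLinearMap.adjoint (CFC.sqrt ρ) = CFC.sqrt ρ :=
    (IsSelfAdjoint.of_nonneg (CFC.sqrt_nonneg ρ)).star_eq
  have hS : opConj (CFC.sqrt ρ) (ContinuousLinearMap.id ℂ E) = ρ := by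
    rw [opConj, hsa, ContinuousLinearMap.id_comp]
    exact CFC.sqrt_mul_sqrt_self ρ h0
  refine ⟨CFC.sqrt ρ, hS, ?_⟩
  have h := hρ.summable.hasSum
  change HasSum _ (opTrace ρ) at h
  convert! h using 1
  ext i
  -- With `S = √ρ` self-adjoint, the diagonal entries of `ρ = S S†` are `‖S b_i‖²`.
  conv_rhs => rw [← hS, re_inner_opConj_id, hsa]

/-- Cyclicity of the trace. -/
theorem opTrace_opConj_opConj_id (T : E →L[ℂ] F) (S : E →L[ℂ] E)
    (hS : Summable fun i => ‖S (someHilbertBasis E i)‖ ^ 2) :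
    HasSum (fun i => ‖T (S (someHilbertBasis E i))‖ ^ 2)
      (opTrace (opConj T (opConj S (ContinuousLinearMap.id ℂ E)))) := by
  have hsum : Summable fun i => ‖(T ∘L S) (someHilbertBasis E i)‖ ^ 2 := by
    refine Summable.of_nonneg_of_le (fun _ => by positivity) (fun i => ?_) (hS.mul_left (‖T‖ ^ 2))
    rw [← mul_pow]
    exact pow_le_pow_left₀ (norm_nonneg _) (T.le_opNorm _) 2
  obtain ⟨s, hs⟩ := hsum
  -- The trace of `(T S)(T S)†` is `∑ ‖(T S)† c_j‖²` over the basis of `F`; passing to the adjoint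
  -- moves it to the basis of `E`.
  have h := hasSum_norm_adjoint_sq _ (someHilbertBasis F) _ hs
  rw [← opConj_comp, opTrace]
  simp_rw [re_inner_opConj_id]
  rw [h.tsum_eq]
  exact hs

/-- The passage from vectors to all density operators: for `ρ = S S†` the two traces are `∑ ‖T S
b_i‖²` and `∑ ‖S b_i‖²`, which compare term by term. -/
theorem opTrace_opConj_of_norm_sq {ρ : E →L[ℂ] E} (hρ : IsDensity ρ) (T : E →L[ℂ] F) {c : ℝ}
    (h : ∀ x, ‖T x‖ ^ 2 = c * ‖x‖ ^ 2) : opTrace (opConj T ρ) = c * opTrace ρ := by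
  obtain ⟨S, hS, hs⟩ := hρ.exists_eq_opConj_id
  have h1 := opTrace_opConj_opConj_id T S hs.summable
  rw [hS] at h1
  simp_rw [h] at h1
  exact h1.unique (hs.mul_left c)

/-- The trace is `∑ ‖T S b_i‖²` for `ρ = S S†`, so its vanishing forces `T S = 0`. -/
theorem opConj_eq_zero_of_opTrace_eq_zero {ρ : E →L[ℂ] E} (hρ : IsDensity ρ) (T : E →L[ℂ] F)
    (h : opTrace (opConj T ρ) = 0) : opConj T ρ = 0 := by
  obtain ⟨S, hS, hs⟩ := hρ.exists_eq_opConj_id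
  have h1 := opTrace_opConj_opConj_id T S hs.summable
  rw [hS, h, hasSum_zero_iff_of_nonneg fun _ => by positivity] at h1
  have h2 : T ∘L S = 0 := (someHilbertBasis E).continuousLinearMap_eq_zero fun i => by
    simpa using congrFun h1 i
  rw [← hS, ← opConj_comp, h2]
  simp [opConj]

theorem opTrace_opConj_nonneg {ρ : E →L[ℂ] E} (hρ : IsDensity ρ) (T : E →L[ℂ] F) :
    0 ≤ opTrace (opConj T ρ) := by
  obtain ⟨S, hS, hs⟩ := hρ.exists_eq_opConj_id
  have h1 := opTrace_opConj_opConj_id T S hs.summable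
  rw [hS] at h1
  exact h1.nonneg fun _ => by positivity

theorem IsDensity.opTrace_pos {ρ : E →L[ℂ] E} (hρ : IsDensity ρ) : 0 < opTrace ρ := by
  have h := opTrace_opConj_nonneg hρ (ContinuousLinearMap.id ℂ E)
  have h' := mt (opConj_eq_zero_of_opTrace_eq_zero hρ (ContinuousLinearMap.id ℂ E))
  rw [opConj_id] at h h'
  exact h.lt_of_ne' (h' hρ.ne_zero)

theorem hasSum_opTrace_rankOne (x : E) :
    HasSum (fun i => (⟪someHilbertBasis E i, InnerProductSpace.rankOne ℂ x x
      (someHilbertBasis E i)⟫_ℂ).re) (‖x‖ ^ 2) := by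
  convert! (someHilbertBasis E).hasSum_norm_inner_sq x using 1
  ext i
  rw [InnerProductSpace.rankOne_apply, inner_smul_right, ← inner_conj_symm, Complex.conj_mul']
  norm_cast

theorem opTrace_rankOne (x : E) : opTrace (InnerProductSpace.rankOne ℂ x x) = ‖x‖ ^ 2 :=
  (hasSum_opTrace_rankOne x).tsum_eq

theorem isDensity_rankOne {x : E} (hx : x ≠ 0) : IsDensity (InnerProductSpace.rankOne ℂ x x) where
  isPositive := InnerProductSpace.isPositive_rankOne_self x
  ne_zero := InnerProductSpace.rankOne_ne_zero hx hx
  summable := (hasSum_opTrace_rankOne x).summable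

/-- If a sum of pure states represents a pure state, then so do all nonzero summands. -/
theorem mem_span_of_sameState_rankOne {κ : Type*} {P : E →L[ℂ] E} {w : κ → E} {y : E}
    (hP : HasSum (fun k => InnerProductSpace.rankOne ℂ (w k) (w k)) P) (hy : y ≠ 0)
    (h : SameState P (InnerProductSpace.rankOne ℂ y y)) (k : κ) :
    w k ∈ Submodule.span ℂ {y} := by
  rw [← Submodule.orthogonal_orthogonal (Submodule.span ℂ {y}), Submodule.mem_orthogonal]
  intro z hz
  have hyz : ⟪y, z⟫_ℂ = 0 := Submodule.mem_orthogonal_singleton_iff_inner_right.1 hz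
  rw [SameState, opTrace_rankOne] at h
  -- If this inverse were zero, the left side of `h` would vanish, while the right side is a nonzero
  -- multiple of `|y⟩⟨y|`.
  have hc : (opTrace P)⁻¹ ≠ 0 := by
    intro hc
    rw [hc, zero_smul, eq_comm, smul_eq_zero, InnerProductSpace.rankOne_eq_zero] at h
    simp [hy] at h
  have hPz : P z = 0 := by
    have := DFunLike.congr_fun h z
    rw [smul_apply, smul_apply, InnerProductSpace.rankOne_apply, hyz,
      zero_smul, smul_zero, smul_eq_zero] at this
    exact this.resolve_left hc
  -- This is `⟪z, P z⟫ = 0` expanded along `hP`; being nonnegative, all terms vanish.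
  have hs : HasSum (fun k => ‖⟪w k, z⟫_ℂ‖ ^ 2) 0 := by
    have h1 := ((hP.mapL (ContinuousLinearMap.apply ℂ E z)).mapL (innerSL ℂ z)).mapL Complex.reCLM
    convert! h1 using 1
    · ext k
      simp only [ContinuousLinearMap.apply_apply, InnerProductSpace.rankOne_apply,
        innerSL_apply_apply, inner_smul_right, Complex.reCLM_apply]
      rw [← inner_conj_symm z, Complex.mul_conj']
      norm_cast
    · simp [hPz]
  rw [hasSum_zero_iff_of_nonneg fun _ => by positivity] at hs
  rw [inner_eq_zero_symm]
  simpa using congrFun hs k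

omit [CompleteSpace E] in
/-- An operator for which every vector is an eigenvector is a scalar. -/
theorem exists_eq_smul_of_forall_mem_span (V : E →L[ℂ] E)
    (h : ∀ x, V x ∈ Submodule.span ℂ {x}) : ∃ c : ℂ, ∀ x, V x = c • x := by
  obtain ⟨c, hc⟩ := (V : E →ₗ[ℂ] E).exists_eq_smul_id_of_forall_notLinearIndependent fun x hx => by
    obtain ⟨k, hk⟩ := Submodule.mem_span_singleton.1 (h x)
    -- The relation `k x - V x = 0` has the nonzero coefficient `-1`.
    have := LinearIndependent.pair_iff.1 hx k (-1) (by simp [hk])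
    simp at this
  exact ⟨c, fun x => by simpa using LinearMap.congr_fun hc x⟩

end Trace

/-! ### Slices of vectors in the tensor product, and the partial trace. -/

section Bipartite

variable {H A : Type*} [NormedAddCommGroup H] [InnerProductSpace ℂ H] [CompleteSpace H]
  [NormedAddCommGroup A] [InnerProductSpace ℂ A]

omit [CompleteSpace H] in
theorem inner_tensorRight (a b : A) (x y : H) :
    ⟪tensorRight a x, tensorRight b y⟫_ℂ = ⟪x, y⟫_ℂ * ⟪a, b⟫_ℂ := by
  rw [tensorRight_apply, tensorRight_apply, UniformSpace.Completion.inner_coe,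
    TensorProduct.inner_tmul]

omit [CompleteSpace H] in
theorem norm_tensorRight_apply (a : A) (x : H) :
    ‖(tensorRight a x : HTensor H A)‖ = ‖x‖ * ‖a‖ := by
  rw [tensorRight_apply, UniformSpace.Completion.norm_coe, TensorProduct.norm_tmul]

omit [CompleteSpace H] in
theorem HTensor.eq_zero_of_inner_eq_zero {w : HTensor H A}
    (h : ∀ (x : H) (a : A), ⟪tensorRight a x, w⟫_ℂ = 0) : w = 0 := by
  refine ext_inner_left ℂ fun v => ?_
  rw [inner_zero_right]
  induction v using UniformSpace.Completion.induction_on with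
  | hp => exact isClosed_eq (by fun_prop) (by fun_prop)
  | ih v =>
    induction v using TensorProduct.induction_on with
    | zero => rw [UniformSpace.Completion.coe_zero, inner_zero_left]
    | tmul x a => exact h x a
    | add u v hu hv => rw [UniformSpace.Completion.coe_add, inner_add_left, hu, hv, add_zero]

variable [CompleteSpace A]

/-- The Hilbert basis of the tensor product formed by the tensor products of basis vectors. -/
noncomputable def HilbertBasis.tensor {ι κ : Type*} (b : HilbertBasis ι ℂ H) (e : HilbertBasis κ ℂ A) :
    HilbertBasis (κ × ι) ℂ (HTensor H A) :=
  HilbertBasis.mkOfOrthogonalEqBot (v := fun p => tensorRight (e p.1) (b p.2))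
    (by
      classical
      rw [orthonormal_iff_ite]
      intro p q
      rw [inner_tensorRight, orthonormal_iff_ite.1 b.orthonormal, orthonormal_iff_ite.1 e.orthonormal]
      by_cases h1 : p.1 = q.1 <;> by_cases h2 : p.2 = q.2 <;> simp [h1, h2, Prod.ext_iff])
    (by
      rw [Submodule.eq_bot_iff]
      intro w hw
      -- Orthogonality to the products of basis vectors is extended to all product vectors one
      -- factor at a time.
      have h0 : ∀ k i, ⟪tensorRight (e k) (b i), w⟫_ℂ = 0 := fun k i =>
        (Submodule.mem_orthogonal _ _).1 hw _ (Submodule.subset_span ⟨(k, i), rfl⟩)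
      have h1 : ∀ k x, ⟪tensorRight (e k) x, w⟫_ℂ = 0 := fun k x => by
        rw [← ContinuousLinearMap.adjoint_inner_right, b.eq_zero_of_inner_eq_zero
          (x := ContinuousLinearMap.adjoint (tensorRight (e k)) w) fun i => by
          rw [ContinuousLinearMap.adjoint_inner_right, h0], inner_zero_right]
      refine HTensor.eq_zero_of_inner_eq_zero fun x a => ?_
      let t : A →L[ℂ] HTensor H A :=
        UniformSpace.Completion.toComplL ∘L TensorProduct.mkL ℂ H A x
      change ⟪t a, w⟫_ℂ = 0
      rw [← ContinuousLinearMap.adjoint_inner_right, e.eq_zero_of_inner_eq_zero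
        (x := ContinuousLinearMap.adjoint t w) fun k => by
        rw [ContinuousLinearMap.adjoint_inner_right]; exact h1 k x, inner_zero_right])

theorem HilbertBasis.tensor_apply {ι κ : Type*} (b : HilbertBasis ι ℂ H) (e : HilbertBasis κ ℂ A)
    (p : κ × ι) : b.tensor e p = tensorRight (e p.1) (b p.2) := by
  rw [HilbertBasis.tensor, HilbertBasis.coe_mkOfOrthogonalEqBot]

/-- The adjoint of `tensorRight (e k)` is the slice map `1 ⊗ ⟨e_k|`; the claim is Parseval for the
product basis, grouped by `k`. -/
theorem HilbertBasis.hasSum_norm_adjoint_tensorRight_sq {κ : Type*} (e : HilbertBasis κ ℂ A)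
    (w : HTensor H A) :
    HasSum (fun k => ‖ContinuousLinearMap.adjoint (tensorRight (H := H) (e k)) w‖ ^ 2)
      (‖w‖ ^ 2) := by
  refine (((someHilbertBasis H).tensor e).hasSum_norm_inner_sq w).prod_fiberwise fun k => ?_
  convert! (someHilbertBasis H).hasSum_norm_inner_sq
    (ContinuousLinearMap.adjoint (tensorRight (H := H) (e k)) w) using 1
  ext i
  rw [HilbertBasis.tensor_apply, ContinuousLinearMap.adjoint_inner_right]

/-- The `tsum` in `partialTrace` would be the default value `0` without convergence. Here the terms
have norms `‖w_k‖²`, which sum to `‖w‖²`. -/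
theorem hasSum_partialTrace_rankOne (w : HTensor H A) :
    HasSum (fun k => InnerProductSpace.rankOne ℂ
        (ContinuousLinearMap.adjoint (tensorRight (H := H) (someHilbertBasis A k)) w)
        (ContinuousLinearMap.adjoint (tensorRight (H := H) (someHilbertBasis A k)) w))
      (partialTrace (InnerProductSpace.rankOne ℂ w w)) := by
  have hterm : ∀ k, ContinuousLinearMap.adjoint (tensorRight (H := H) (someHilbertBasis A k)) ∘L
      InnerProductSpace.rankOne ℂ w w ∘L tensorRight (someHilbertBasis A k) =
      InnerProductSpace.rankOne ℂ
        (ContinuousLinearMap.adjoint (tensorRight (H := H) (someHilbertBasis A k)) w)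
        (ContinuousLinearMap.adjoint (tensorRight (H := H) (someHilbertBasis A k)) w) := fun k => by
    rw [InnerProductSpace.rankOne_comp, InnerProductSpace.comp_rankOne]
  simp only [partialTrace, hterm]
  refine (Summable.of_norm ?_).hasSum
  simp only [InnerProductSpace.norm_rankOne, ← sq]
  exact ((someHilbertBasis A).hasSum_norm_adjoint_tensorRight_sq w).summable

/-- If the reduced output of `W` on every pure state, where nonzero, is the pure state obtained by
applying `U`, then `W` is a multiple of an isometry. -/
theorem exists_norm_sq_eq_of_sameState_partialTrace (W : H →L[ℂ] HTensor H A) {U : H →L[ℂ] H}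
    (hU : U ∈ unitary (H →L[ℂ] H))
    (h : ∀ x, W x ≠ 0 → SameState (partialTrace (InnerProductSpace.rankOne ℂ (W x) (W x)))
      (InnerProductSpace.rankOne ℂ (U x) (U x))) :
    ∃ c : ℝ, ∀ x, ‖W x‖ ^ 2 = c * ‖x‖ ^ 2 := by
  have hUU : ∀ x, ContinuousLinearMap.adjoint U (U x) = x := fun x =>
    DFunLike.congr_fun (Unitary.star_mul_self_of_mem hU) x
  have hUU' : ∀ x, U (ContinuousLinearMap.adjoint U x) = x := fun x =>
    DFunLike.congr_fun (Unitary.mul_star_self_of_mem hU) x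
  have hnorm : ∀ x, ‖U x‖ = ‖x‖ := fun x => by
    rw [← sq_eq_sq₀ (norm_nonneg _) (norm_nonneg _), ← inner_self_eq_norm_sq (𝕜 := ℂ),
      ← inner_self_eq_norm_sq (𝕜 := ℂ), ← ContinuousLinearMap.adjoint_inner_right, hUU]
  have hspan : ∀ k x, ContinuousLinearMap.adjoint (tensorRight (H := H) (someHilbertBasis A k))
      (W x) ∈ Submodule.span ℂ {U x} := by
    intro k x
    -- Where `W x = 0` the path has probability zero and `h` says nothing, but the slices vanish
    -- too.
    by_cases hx : W x = 0
    · rw [hx, map_zero]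
      exact zero_mem _
    · refine mem_span_of_sameState_rankOne (hasSum_partialTrace_rankOne (W x)) (fun h0 => hx ?_)
        (h x hx) k
      rw [← hUU x, h0, map_zero, map_zero]
  have hc : ∀ k, ∃ c : ℂ, ∀ x, ContinuousLinearMap.adjoint
      (tensorRight (H := H) (someHilbertBasis A k)) (W x) = c • U x := by
    intro k
    obtain ⟨c, hc⟩ := exists_eq_smul_of_forall_mem_span (ContinuousLinearMap.adjoint U ∘L
      ContinuousLinearMap.adjoint (tensorRight (H := H) (someHilbertBasis A k)) ∘L W) fun x => by
        obtain ⟨k', hk'⟩ := Submodule.mem_span_singleton.1 (hspan k x)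
        simp only [ContinuousLinearMap.comp_apply, ← hk', map_smul, hUU]
        exact Submodule.smul_mem _ _ (Submodule.mem_span_singleton_self x)
    refine ⟨c, fun x => ?_⟩
    rw [← map_smul, ← hc x]
    exact (hUU' _).symm
  choose c hc using hc
  -- Over a field `tsum_mul_right` holds unconditionally, so summability of `‖c k‖ ^ 2` need not be
  -- shown.
  refine ⟨∑' k, ‖c k‖ ^ 2, fun x => ?_⟩
  rw [← ((someHilbertBasis A).hasSum_norm_adjoint_tensorRight_sq (W x)).tsum_eq, ← tsum_mul_right]
  exact tsum_congr fun k => by rw [hc, norm_smul, hnorm, mul_pow]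

end Bipartite

/-! ### Path probabilities in a circuit. -/

theorem prod_range_div_of_zero_absorbing (t : ℕ → ℝ) (h0 : t 0 ≠ 0)
    (h : ∀ n, t n = 0 → t (n + 1) = 0) (N : ℕ) :
    ∏ n ∈ Finset.range N, t (n + 1) / t n = t N / t 0 := by
  induction N with
  | zero => simp [h0]
  | succ N ih =>
    rw [Finset.prod_range_succ, ih]
    -- After a zero, both sides stay zero, since division by zero gives zero.
    by_cases hN : t N = 0
    · simp [hN, h N hN]
    · field_simp

namespace QCircuit

section

variable {K : Type*} [NormedAddCommGroup K] [InnerProductSpace ℂ K] [CompleteSpace K]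

/-- The operator by which the first `n` bouts act along the path `μ`. -/
noncomputable def pathOp (C : QCircuit K) (μ : C.Path) : ℕ → (K →L[ℂ] K)
  | 0 => ContinuousLinearMap.id ℂ K
  | n + 1 => C.boutOp μ n ∘L pathOp C μ n

theorem stateAfter_eq_opConj_pathOp (C : QCircuit K) (μ : C.Path) (σ : K →L[ℂ] K) (n : ℕ) :
    C.stateAfter μ σ n = opConj (C.pathOp μ n) σ := by
  induction n with
  | zero => exact (opConj_id σ).symm
  | succ n ih => rw [stateAfter, ih, pathOp, opConj_comp]

end

variable {H A : Type*} [NormedAddCommGroup H] [InnerProductSpace ℂ H] [CompleteSpace H]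
  [NormedAddCommGroup A] [InnerProductSpace ℂ A] [CompleteSpace A]

omit [CompleteSpace A] in
-- Absorbing the ancilla into the operator keeps `ρ` on `H` as the only density operator, so
-- `withAncilla a ρ` need not be shown to be one.
theorem stateAfter_withAncilla (C : QCircuit (HTensor H A)) (μ : C.Path) (a : A)
    (ρ : H →L[ℂ] H) (n : ℕ) :
    C.stateAfter μ (withAncilla a ρ) n = opConj (C.pathOp μ n ∘L tensorRight a) ρ := by
  rw [stateAfter_eq_opConj_pathOp, opConj_comp, withAncilla]

/-- For a unit vector `a` the map `x ↦ x ⊗ a` is isometric, so the initial trace is `Tr ρ`; a state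
of trace zero is zero and remains so, hence the quotients telescope. -/
theorem prob_withAncilla (C : QCircuit (HTensor H A)) (μ : C.Path) {a : A} (ha : ‖a‖ = 1)
    {ρ : H →L[ℂ] H} (hρ : IsDensity ρ) :
    C.prob μ (withAncilla a ρ) =
      opTrace (opConj (C.pathOp μ C.numStages ∘L tensorRight a) ρ) / opTrace ρ := by
  have h0 : opTrace (C.stateAfter μ (withAncilla a ρ) 0) = opTrace ρ := by
    rw [stateAfter, withAncilla, opTrace_opConj_of_norm_sq hρ (c := 1), one_mul]
    intro x
    rw [norm_tensorRight_apply, ha, mul_one, one_mul]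
  rw [prob, prod_range_div_of_zero_absorbing
    (fun n => opTrace (C.stateAfter μ (withAncilla a ρ) n)), h0, stateAfter_withAncilla]
  · rw [h0]
    exact hρ.opTrace_pos.ne'
  · intro n hn
    rw [stateAfter_withAncilla] at hn
    rw [stateAfter, stateAfter_withAncilla, opConj_eq_zero_of_opTrace_eq_zero hρ _ hn, opConj_zero]
    simp [opTrace]

/-- A circuit that computes a unitary operator along one path follows this path with the same
probability on all inputs. -/
theorem ComputesAlong.exists_prob_eq {C : QCircuit (HTensor H A)} {a : A} {U : H →L[ℂ] H}
    {μ : C.Path} (h : C.ComputesAlong a U μ) (ha : ‖a‖ = 1) (hU : U ∈ unitary (H →L[ℂ] H)) :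
    ∃ c : ℝ, ∀ ρ : H →L[ℂ] H, IsDensity ρ → C.prob μ (withAncilla a ρ) = c := by
  obtain ⟨c, hc⟩ := exists_norm_sq_eq_of_sameState_partialTrace
    (C.pathOp μ C.numStages ∘L tensorRight a) hU fun x hx => by
      have hx0 : x ≠ 0 := fun h0 => hx (by rw [h0, map_zero])
      -- On the pure input `|x⟩⟨x|` the path has probability `‖W x‖² / ‖x‖² > 0`.
      have := h _ (isDensity_rankOne hx0) (by
        rw [prob_withAncilla C μ ha (isDensity_rankOne hx0), opConj_rankOne, opTrace_rankOne,
          opTrace_rankOne]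
        have := norm_pos_iff.2 hx
        have := norm_pos_iff.2 hx0
        positivity)
      rwa [out, stateAfter_withAncilla, opConj_rankOne, opConj_rankOne] at this
  refine ⟨c, fun ρ hρ => ?_⟩
  rw [prob_withAncilla C μ ha hρ, opTrace_opConj_of_norm_sq hρ _ hc,
    mul_div_cancel_right₀ _ hρ.opTrace_pos.ne']

end QCircuit

/-! ### Single measurements, and the conclusion. -/

/-- No information without disturbance, for one outcome of a measurement. -/
theorem Measurement.exists_prob_eq {H : Type*} [NormedAddCommGroup H] [InnerProductSpace ℂ H]
    [CompleteSpace H] {I : Type*} (M : Measurement H I) (i : I)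
    (h : ∀ ρ : H →L[ℂ] H, IsDensity ρ → 0 < M.prob i ρ → SameState (opConj (M.op i) ρ) ρ) :
    ∃ c : ℝ, ∀ ρ : H →L[ℂ] H, IsDensity ρ → M.prob i ρ = c := by
  obtain ⟨c, hc⟩ := exists_eq_smul_of_forall_mem_span (M.op i) fun x => by
    by_cases hx : M.op i x = 0
    · rw [hx]
      exact zero_mem _
    have hx0 : x ≠ 0 := fun h0 => hx (by rw [h0, map_zero])
    have hsame := h _ (isDensity_rankOne hx0) (by
      rw [Measurement.prob, opConj_rankOne, opTrace_rankOne, opTrace_rankOne]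
      have := norm_pos_iff.2 hx
      have := norm_pos_iff.2 hx0
      positivity)
    rw [opConj_rankOne] at hsame
    -- Without an ancilla the sum of pure states has just one term.
    exact mem_span_of_sameState_rankOne (w := fun _ : Unit => M.op i x)
      (hasSum_unique _) hx0 hsame ()
  refine ⟨‖c‖ ^ 2, fun ρ hρ => ?_⟩
  rw [Measurement.prob, opTrace_opConj_of_norm_sq hρ (c := ‖c‖ ^ 2), mul_div_cancel_right₀ _
    hρ.opTrace_pos.ne']
  intro x
  rw [hc, norm_smul, mul_pow]

theorem corollary1p3 {H A : Type*}
    [NormedAddCommGroup H] [InnerProductSpace ℂ H] [CompleteSpace H]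
    [TopologicalSpace.SeparableSpace H]
    [NormedAddCommGroup A] [InnerProductSpace ℂ A] [CompleteSpace A]
    [TopologicalSpace.SeparableSpace A]
    (hdim : 2 ≤ Module.rank ℂ H) :
    -- circuits that compute the same unitary operator along every computation path
    (∀ (C : QCircuit (HTensor H A)) (a : A), ‖a‖ = 1 →
      ∀ U ∈ unitary (H →L[ℂ] H), (∀ μ : C.Path, C.ComputesAlong a U μ) →
        ∀ (μ : C.Path) (ρ ρ' : H →L[ℂ] H), IsDensity ρ → IsDensity ρ' →
          C.prob μ (withAncilla a ρ) = C.prob μ (withAncilla a ρ')) ∧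
    -- special case of one measurement and the identity operator: no information without disturbance
    (∀ (I : Type) [Countable I] (M : Measurement H I),
      (∀ (i : I) (ρ : H →L[ℂ] H), IsDensity ρ → 0 < M.prob i ρ →
        SameState (opConj (M.op i) ρ) ρ) →
      ∀ (i : I) (ρ ρ' : H →L[ℂ] H), IsDensity ρ → IsDensity ρ' →
        M.prob i ρ = M.prob i ρ') := by
  refine ⟨fun C a ha U hU h μ ρ ρ' hρ hρ' => ?_, fun I _ M h i ρ ρ' hρ hρ' => ?_⟩
  · obtain ⟨c, hc⟩ := (h μ).exists_prob_eq ha hU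
    rw [hc ρ hρ, hc ρ' hρ']
  · obtain ⟨c, hc⟩ := M.exists_prob_eq i (h i)
    rw [hc ρ hρ, hc ρ' hρ']
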